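/- Let $\Omega\subset\mathbb C^n$ be a bounded domain. Put $\|f\|_p=\left(\int_\Omega|f|^p\right)^{1/p}$ (integral with respect to Lebesgue measure), and let $A^1(\Omega)$ be the space of holomorphic functions $f$ on $\Omega$ with $\|f\|_1<\infty$. For $z\in\Omega$ let $$K_1(z)=\max\{|f(z)|: f\in A^1(\Omega),\ \|f\|_1=1\},$$ let $m_1(\cdot,z)$ be the unique function minimizing $\|f\|_1$ among all $f\in A^1(\Omega)$ with $f(z)=1$, and let $K_1(\zeta,z)=m_1(\zeta,z)K_1(z)$ for $\zeta\in\Omega$ be the off-diagonal $1$-Bergman kernel of $\Omega$. Fix $z\in\Omega$ and set $S_z=\{\zeta\in\Omega: K_1(\zeta,z)=0\}$. Then for every neighbourhood $U$ of $z$ that is relatively compact in $\Omega\setminus S_z$ (i.e. $\overline U$ is compact and $\overline U\subset\Omega\setminus S_z$) there exists a constant $C>0$ such that, for all $\zeta,z'\in U$, $$|K_1(\zeta,z)-K_1(\zeta,z')|\le C\,|z-z'|^{1/2}\left(\|K_1(\cdot,z)-K_1(\cdot,z')\|_1^{1/2}+|z-z'|^{1/2}\right).$$ -/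

import Mathlib

open MeasureTheory Set Topology

noncomputable section

namespace PBergman

variable {n : ℕ}

/-- A bounded domain: a bounded, open, connected, nonempty set in `ℂⁿ`. -/
structure IsBoundedDomain (Ω : Set (EuclideanSpace ℂ (Fin n))) : Prop where
  isOpen : IsOpen Ω
  isConnected : IsConnected Ω
  isBounded : Bornology.IsBounded Ω

/-- The quantity `‖f‖_p = (∫_Ω |f|^p)^{1/p}`, the integral being with respect to Lebesgue measure
on `ℂⁿ`. -/
def pNorm (p : ℝ) (Ω : Set (EuclideanSpace ℂ (Fin n))) (f : EuclideanSpace ℂ (Fin n) → ℂ) : ℝ :=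
  (∫ ζ in Ω, ‖f ζ‖ ^ p) ^ (1 / p)

/-- The `p`-Bergman space `A^p(Ω)`: functions holomorphic on `Ω` with `∫_Ω |f|^p < ∞`.
Functions on `Ω` are represented by functions on `ℂⁿ`, whose values outside `Ω` play no role. -/
def bergmanSpace (p : ℝ) (Ω : Set (EuclideanSpace ℂ (Fin n))) :
    Set (EuclideanSpace ℂ (Fin n) → ℂ) :=
  {f | DifferentiableOn ℂ f Ω ∧ IntegrableOn (fun ζ => ‖f ζ‖ ^ p) Ω}

/-- The diagonal `p`-Bergman kernel `K_p(z) = max {|f(z)|^p : f ∈ A^p(Ω), ‖f‖_p = 1}`. -/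
def diagKernel (p : ℝ) (Ω : Set (EuclideanSpace ℂ (Fin n))) (z : EuclideanSpace ℂ (Fin n)) : ℝ :=
  sSup {t : ℝ | ∃ f ∈ bergmanSpace p Ω, pNorm p Ω f = 1 ∧ t = ‖f z‖ ^ p}

/-- `f` solves the minimum problem `min {‖f‖_p : f ∈ A^p(Ω), f(z) = 1}`. -/
structure IsMinimizer (p : ℝ) (Ω : Set (EuclideanSpace ℂ (Fin n)))
    (z : EuclideanSpace ℂ (Fin n)) (f : EuclideanSpace ℂ (Fin n) → ℂ) : Prop where
  mem : f ∈ bergmanSpace p Ω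
  apply_eq_one : f z = 1
  le : ∀ g ∈ bergmanSpace p Ω, g z = 1 → pNorm p Ω f ≤ pNorm p Ω g

open Classical in
/-- The minimizer `m_p(·, z)`. For `1 ≤ p < ∞`, `Ω` a bounded domain and `z ∈ Ω` a minimizer exists
and its restriction to `Ω` is unique; the value `0` of the other branch is then never used. -/
def minimizer (p : ℝ) (Ω : Set (EuclideanSpace ℂ (Fin n)))
    (ζ z : EuclideanSpace ℂ (Fin n)) : ℂ :=
  if h : ∃ f, IsMinimizer p Ω z f then h.choose ζ else 0

/-- The off-diagonal `p`-Bergman kernel `K_p(ζ, z) = m_p(ζ, z) K_p(z)`. -/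
def bergmanKernel (p : ℝ) (Ω : Set (EuclideanSpace ℂ (Fin n)))
    (ζ z : EuclideanSpace ℂ (Fin n)) : ℂ :=
  minimizer p Ω ζ z * (diagKernel p Ω z : ℂ)

/-- The zero set `S_z = {ζ ∈ Ω : K_1(ζ, z) = 0}`. -/
def zeroSet (Ω : Set (EuclideanSpace ℂ (Fin n))) (z : EuclideanSpace ℂ (Fin n)) :
    Set (EuclideanSpace ℂ (Fin n)) :=
  {ζ ∈ Ω | bergmanKernel 1 Ω ζ z = 0}

end PBergman

end

/-! Write k = K_1(·,z), k' = K_1(·,z'), h = k - k', T = |z-z'| ‖h‖_1, and study the quotient F =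
k'/k off the zeros of k.

The first variation of the minimum problem gives the reproducing formula ∫ Re(conj(k) f)/|k| = Re
f(z)/K_1(z). Taking f = k' and using ‖k'‖_1 = 1, the nonnegative deficit D = |k'| - Re(conj(k)
k')/|k| has integral Re h(z)/K_1(z). The corresponding deficit with z and z' exchanged is also
nonnegative; adding it leaves Re h(z)/K_1(z) - Re h(z')/K_1(z'). This difference of values at nearby
points is O(T), because point evaluations on A^1 are locally Lipschitz and so is K_1
(`exists_integral_norm_sub_re_conj_mul_div_le`).

Where k is bounded below, (Im F)² ≤ C·D pointwise (`Complex.sq_im_div_le`). The mean value property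
turns the integral bound into |Im F| ≤ C√T, and Borel-Carathéodory bounds the oscillation of F by
C√T on a smaller ball. At z itself F - 1 = O(|z-z'|). Since Ω without the zeros of k is connected,
the estimate |F - 1| ≤ C(√T + |z-z'|) spreads from z to every compact subset
(`exists_norm_div_sub_one_le`); multiplication by k finishes.

Existence of minimizers comes from Montel and Fatou. The argument holds for whichever minimizer is
chosen. -/

section NormedSpace

variable {E : Type*} [NormedAddCommGroup E] [NormedSpace ℂ E]

/-! ### Cauchy estimates and pointwise limits of holomorphic functions. -/

open Metric in
/-- Lipschitz estimate for a bounded holomorphic function. -/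
theorem DifferentiableOn.norm_sub_le_of_norm_le {f : E → ℂ} {x y : E} {R M : ℝ}
    (hf : DifferentiableOn ℂ f (ball x R)) (hM : ∀ w ∈ ball x R, ‖f w‖ ≤ M)
    (hy : y ∈ ball x R) : ‖f y - f x‖ ≤ 2 * M / R * ‖y - x‖ := by
  have hx : x ∈ ball x R := mem_ball_self (nonempty_ball.1 ⟨y, hy⟩)
  have := Complex.dist_le_div_mul_dist_of_mapsTo_ball (R₂ := 2 * M) hf (fun w hw => by
    rw [mem_closedBall, dist_eq_norm]
    linarith [norm_sub_le (f w) (f x), hM w hw, hM x hx]) hy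
  simpa only [dist_eq_norm] using this

open Metric in
theorem DifferentiableOn.norm_fderiv_le_of_norm_le {f : E → ℂ} {x : E} {R M : ℝ} (hR : 0 < R)
    (hf : DifferentiableOn ℂ f (ball x R)) (hM : ∀ w ∈ ball x R, ‖f w‖ ≤ M) :
    ‖fderiv ℂ f x‖ ≤ 2 * M / R := by
  refine Complex.norm_fderiv_le_div_of_mapsTo_ball (R₂ := 2 * M) hf (fun w hw => ?_) hR
  rw [mem_closedBall, dist_eq_norm]
  linarith [norm_sub_le (f w) (f x), hM w hw, hM x (mem_ball_self hR)]

open Metric in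
/-- First order Taylor estimate for a bounded holomorphic function. -/
theorem DifferentiableOn.norm_sub_sub_fderiv_le {f : E → ℂ} {x y : E} {R M : ℝ}
    (hf : DifferentiableOn ℂ f (ball x R)) (hM : ∀ w ∈ ball x R, ‖f w‖ ≤ M)
    (hy : y ∈ ball x R) :
    ‖f y - f x - fderiv ℂ f x (y - x)‖ ≤ 4 * M * (‖y - x‖ / R) ^ 2 := by
  have hR : 0 < R := nonempty_ball.1 ⟨y, hy⟩
  have hx : x ∈ ball x R := mem_ball_self hR
  have hM0 : 0 ≤ M := (norm_nonneg _).trans (hM x hx)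
  have hD : HasFDerivAt f (fderiv ℂ f x) x :=
    (hf.differentiableAt (isOpen_ball.mem_nhds hx)).hasFDerivAt
  -- Schwarz lemma at order two: without its linear part f is f(x) + o(|w-x|), and it deviates from
  -- f(x) by at most 2M + 2M on the ball.
  have key := Complex.dist_le_mul_div_pow_of_mapsTo_ball_of_isLittleO (n := 1) (R₂ := 4 * M)
    (f := fun w => f w - fderiv ℂ f x (w - x)) (c := x) (z := y) (R₁ := R)
    (hf.sub (by fun_prop)) (fun w hw => by
      rw [mem_closedBall, dist_eq_norm]
      have h1 := (fderiv ℂ f x).le_opNorm (w - x)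
      have h2 := hf.norm_fderiv_le_of_norm_le hR hM
      have h3 : ‖w - x‖ ≤ R := by rw [mem_ball, dist_eq_norm] at hw; exact hw.le
      have h4 : ‖fderiv ℂ f x (w - x)‖ ≤ 2 * M := by
        calc _ ≤ 2 * M / R * R := h1.trans (by gcongr)
          _ = 2 * M := by field_simp
      have h5 : f w - fderiv ℂ f x (w - x) - (f x - fderiv ℂ f x (x - x))
          = f w - f x - fderiv ℂ f x (w - x) := by simp; ring
      rw [h5]
      linarith [norm_sub_le (f w - f x) (fderiv ℂ f x (w - x)), norm_sub_le (f w) (f x),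
        hM w hw, hM x hx]) (by
      have := hD.isLittleO
      simp only [pow_one]
      refine (this.congr_left fun w => ?_).norm_right
      simp; ring) hy
  rw [dist_eq_norm, dist_eq_norm] at key
  refine le_trans (le_of_eq ?_) key
  congr 1
  simp; ring

open Metric Filter in
/-- A pointwise limit of uniformly bounded holomorphic functions is holomorphic. -/
theorem differentiableAt_of_tendsto_of_norm_le [FiniteDimensional ℂ E] {F : ℕ → E → ℂ}
    {f : E → ℂ} {x : E} {R M : ℝ} (hR : 0 < R)
    (hF : ∀ j, DifferentiableOn ℂ (F j) (ball x R)) (hM : ∀ j, ∀ w ∈ ball x R, ‖F j w‖ ≤ M)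
    (hlim : ∀ w ∈ ball x R, Tendsto (fun j => F j w) atTop (𝓝 (f w))) :
    DifferentiableAt ℂ f x := by
  have : ProperSpace (E →L[ℂ] ℂ) := FiniteDimensional.proper ℂ _
  -- The candidate derivative is a limit point of the bounded derivatives at x; the quadratic Taylor
  -- bound is uniform in j and survives the limit.
  obtain ⟨D, -, φ, hφ, hD⟩ := (isCompact_closedBall (0 : E →L[ℂ] ℂ) (2 * M / R)).tendsto_subseq
    (x := fun j => fderiv ℂ (F j) x) fun j => by
      simpa using (hF j).norm_fderiv_le_of_norm_le hR (hM j)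
  have hx : x ∈ ball x R := mem_ball_self hR
  have key : ∀ y ∈ ball x R, ‖f y - f x - D (y - x)‖ ≤ 4 * M * (‖y - x‖ / R) ^ 2 := by
    intro y hy
    have h1 : Tendsto (fun j => ‖F (φ j) y - F (φ j) x - fderiv ℂ (F (φ j)) x (y - x)‖) atTop
        (𝓝 ‖f y - f x - D (y - x)‖) := by
      refine ((((hlim y hy).comp hφ.tendsto_atTop).sub
        ((hlim x hx).comp hφ.tendsto_atTop)).sub ?_).norm
      exact ((ContinuousLinearMap.apply ℂ ℂ (y - x)).continuous.tendsto D).comp hD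
    exact le_of_tendsto' h1 fun j => (hF _).norm_sub_sub_fderiv_le (hM _) hy
  suffices HasFDerivAt f D x from this.differentiableAt
  refine .of_isLittleO ?_
  refine Asymptotics.IsBigO.trans_isLittleO (g := fun y => ‖y - x‖ ^ 2) ?_ ?_
  · refine Asymptotics.IsBigO.of_bound (4 * M / R ^ 2) ?_
    filter_upwards [isOpen_ball.mem_nhds hx] with y hy
    refine (key y hy).trans (le_of_eq ?_)
    rw [norm_pow, norm_norm]
    ring
  · have h0 : Tendsto (fun y => ‖y - x‖) (𝓝 x) (𝓝 0) := by
      have : Continuous fun y : E => ‖y - x‖ := by fun_prop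
      simpa using this.tendsto x
    have := (Asymptotics.isLittleO_pow_id (𝕜 := ℝ) (n := 2) one_lt_two).comp_tendsto h0
    exact this.of_norm_right

/-! ### Identity theorem and zero sets, by restriction to complex lines. -/

open Metric in
theorem isOpen_convex_preimage_line {s : Set E} (hs : IsOpen s) (hc : Convex ℝ s) (a v : E) :
    IsOpen {t : ℂ | a + t • v ∈ s} ∧ Convex ℝ {t : ℂ | a + t • v ∈ s} := by
  refine ⟨hs.preimage (by fun_prop), fun t ht u hu α β hα hβ hαβ => ?_⟩
  have := hc ht hu hα hβ hαβ
  simp only [mem_ofPred_eq]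
  convert this using 1
  have h : a = α • a + β • a := by rw [← add_smul, hαβ, one_smul]
  nth_rewrite 1 [h]
  simp only [smul_add, add_smul, smul_assoc]
  abel

theorem DifferentiableOn.analyticOnNhd_line {s : Set E} (hs : IsOpen s) (hc : Convex ℝ s)
    {f : E → ℂ} (hf : DifferentiableOn ℂ f s) (a v : E) :
    AnalyticOnNhd ℂ (fun t : ℂ => f (a + t • v)) {t : ℂ | a + t • v ∈ s} :=
  DifferentiableOn.analyticOnNhd (hf.comp (by fun_prop) fun _ ht => ht)
    (isOpen_convex_preimage_line hs hc a v).1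

open Metric Filter in
/-- The identity theorem for holomorphic functions on a connected open set. -/
theorem DifferentiableOn.eqOn_zero_of_isPreconnected {Ω : Set E} (hΩ : IsOpen Ω)
    (hc : IsPreconnected Ω) {f : E → ℂ} (hf : DifferentiableOn ℂ f Ω) {b : E} (hb : b ∈ Ω)
    (hfb : ∀ᶠ y in 𝓝 b, f y = 0) : EqOn f 0 Ω := by
  have key : Ω ⊆ {x | ∀ᶠ y in 𝓝 x, f y = 0} := by
    refine hc.subset_of_closure_inter_subset isOpen_setOfPred_eventually_nhds ⟨b, hb, hfb⟩ ?_
    rintro x ⟨hx, hxΩ⟩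
    obtain ⟨r, hr, hrΩ⟩ := isOpen_iff.1 hΩ x hxΩ
    obtain ⟨a, ha, hax⟩ := mem_closure_iff.1 hx r hr
    have haB : a ∈ ball x r := by rwa [mem_ball, dist_comm]
    filter_upwards [ball_mem_nhds x hr] with y hy
    -- On the complex line through a and y, the parameters landing in the ball form a convex set
    -- containing 0, near which f vanishes, and 1, which is y.
    have hW := isOpen_convex_preimage_line (E := E) isOpen_ball
      (convex_ball (E := E) x r) a (y - a)
    have h0 : (0 : ℂ) ∈ {t : ℂ | a + t • (y - a) ∈ ball x r} := by simpa using haB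
    have h1 : (1 : ℂ) ∈ {t : ℂ | a + t • (y - a) ∈ ball x r} := by simpa using hy
    have := ((hf.mono hrΩ).analyticOnNhd_line isOpen_ball (convex_ball x r) a
      (y - a)).eqOn_zero_of_preconnected_of_eventuallyEq_zero hW.2.isPreconnected h0 (by
        have hcont : Tendsto (fun t : ℂ => a + t • (y - a)) (𝓝 0) (𝓝 a) := by
          have : Continuous (fun t : ℂ => a + t • (y - a)) := by fun_prop
          simpa using this.tendsto 0
        exact hcont.eventually ha)
    simpa using this h1
  exact fun x hx => (key hx).self_of_nhds

open Metric Filter in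
/-- The complement of the zero set of a holomorphic function is connected. -/
theorem DifferentiableOn.isPreconnected_setOf_ne_zero {Ω : Set E} (hΩ : IsOpen Ω)
    (hc : IsPreconnected Ω) {f : E → ℂ} (hf : DifferentiableOn ℂ f Ω) :
    IsPreconnected {x ∈ Ω | f x ≠ 0} := by
  rw [isPreconnected_iff_subset_of_disjoint]
  intro u v hu hv huv hd
  have hopen : IsOpen {x ∈ Ω | f x ≠ 0} := hf.continuousOn.isOpen_inter_preimage hΩ
    isOpen_compl_singleton
  by_contra! hcon
  obtain ⟨⟨a, ha, hau⟩, ⟨b, hb, hbv⟩⟩ := And.imp not_subset.1 not_subset.1 hcon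
  have hav : a ∈ v := (huv ha).resolve_left hau
  have hbu : b ∈ u := (huv hb).resolve_right hbv
  classical
  -- Squaring makes the gluing holomorphic across the zeros of f: there g = O(|y-x|²), so its
  -- derivative exists and is 0.
  set g : E → ℂ := fun x => if x ∈ u then f x ^ 2 else 0 with hg
  have hgd : DifferentiableOn ℂ g Ω := by
    intro x hx
    apply DifferentiableAt.differentiableWithinAt
    have hfx : DifferentiableAt ℂ f x := hf.differentiableAt (hΩ.mem_nhds hx)
    by_cases hx0 : f x = 0
    · have h1 : (fun y => f y) =O[𝓝 x] fun y => y - x := by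
        simpa [hx0] using hfx.isBigO_sub
      have h2 : g =O[𝓝 x] fun y => ‖y - x‖ ^ 2 := by
        refine Asymptotics.IsBigO.trans ?_ (h1.norm_right.pow 2)
        refine Asymptotics.IsBigO.of_bound 1 (.of_forall fun y => ?_)
        by_cases hy : y ∈ u <;> simp [hg, hy]
      have hgx : g x = 0 := by simp [hg, hx0]
      have h0 : Tendsto (fun y => ‖y - x‖) (𝓝 x) (𝓝 0) := by
        have : Continuous fun y : E => ‖y - x‖ := by fun_prop
        simpa using this.tendsto x
      have h3 := (Asymptotics.isLittleO_pow_id (𝕜 := ℝ) (n := 2) one_lt_two).comp_tendsto h0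
      have : HasFDerivAt g (0 : E →L[ℂ] ℂ) x := .of_isLittleO (by
        simpa [hgx] using h2.trans_isLittleO h3 |>.of_norm_right)
      exact this.differentiableAt
    · have hxs : x ∈ {x ∈ Ω | f x ≠ 0} := ⟨hx, hx0⟩
      by_cases hxu : x ∈ u
      · refine (hfx.pow 2).congr_of_eventuallyEq ?_
        filter_upwards [hu.mem_nhds hxu] with y hy
        simp [hg, hy]
      · have hxv := (huv hxs).resolve_left hxu
        refine (differentiableAt_const (0 : ℂ)).congr_of_eventuallyEq ?_
        filter_upwards [hv.mem_nhds hxv, hopen.mem_nhds hxs] with y hy hys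
        have : y ∉ u := fun hyu => (hd ▸ (⟨hys, hyu, hy⟩ : y ∈ _ ∩ (u ∩ v)) : y ∈ (∅ : Set E))
        simp [hg, this]
  have hz : ∀ᶠ y in 𝓝 a, g y = 0 := by
    filter_upwards [hv.mem_nhds hav, hopen.mem_nhds ha] with y hy hys
    have : y ∉ u := fun hyu => (hd ▸ (⟨hys, hyu, hy⟩ : y ∈ _ ∩ (u ∩ v)) : y ∈ (∅ : Set E))
    simp [hg, this]
  have := hgd.eqOn_zero_of_isPreconnected hΩ hc ha.1 hz hb.1
  simp [hg, hbu, hb.2] at this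

open Metric Filter in
-- The restriction to the line is analytic on a connected planar set and nonzero at t = 0, so its
-- zeros are discrete, hence countable.
theorem DifferentiableOn.countable_zeros_line {s : Set E} (hs : IsOpen s) (hc : Convex ℝ s)
    {f : E → ℂ} (hf : DifferentiableOn ℂ f s) {a : E} (ha : a ∈ s) (hfa : f a ≠ 0) (v : E) :
    {t : ℂ | a + t • v ∈ s ∧ f (a + t • v) = 0}.Countable := by
  have hW := isOpen_convex_preimage_line hs hc a v
  have h0 : (0 : ℂ) ∈ {t : ℂ | a + t • v ∈ s} := by simpa using ha
  rcases (hf.analyticOnNhd_line hs hc a v).eqOn_zero_or_eventually_ne_zero_of_preconnected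
    hW.2.isPreconnected with h | h
  · exact absurd (by simpa using h h0) hfa
  · have hd := isDiscrete_of_codiscreteWithin (s := {t : ℂ | f (a + t • v) = 0}) h
    refine ((HereditarilyLindelofSpace.isLindelof _).countable_of_isDiscrete hd).mono ?_
    exact fun t ht => ⟨ht.2, ht.1⟩

end NormedSpace

/-! ### Zero sets are Lebesgue null. -/

section NullSet

variable {E : Type*} [NormedAddCommGroup E] [NormedSpace ℂ E] [FiniteDimensional ℂ E]
  [MeasurableSpace E] [BorelSpace E]

/-- Real lines through a meet the zero set in countably many parameters. By Fubini for (x,t) ↦ a +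
t(x-a), some t ≠ 0 has a null slice, and that slice is a translated dilate of the zero set. -/
theorem DifferentiableOn.measure_zeros_eq_zero_of_convex (μ : Measure E) [μ.IsAddHaarMeasure]
    {s : Set E} (hs : IsOpen s) (hc : Convex ℝ s) {f : E → ℂ} (hf : DifferentiableOn ℂ f s)
    {a : E} (ha : a ∈ s) (hfa : f a ≠ 0) : μ {x ∈ s | f x = 0} = 0 := by
  have : ProperSpace E := FiniteDimensional.proper ℂ E
  set Z : Set E := {x ∈ s | f x = 0} with hZ
  have hZm : MeasurableSet Z := by
    have h1 : IsOpen (s ∩ f ⁻¹' {0}ᶜ) :=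
      hf.continuousOn.isOpen_inter_preimage hs isOpen_compl_singleton
    have h2 : Z = s \ (s ∩ f ⁻¹' {0}ᶜ) := by
      ext x; simp [hZ]
    rw [h2]
    exact hs.measurableSet.diff h1.measurableSet
  have hline : ∀ x : E, volume {t : ℝ | a + t • (x - a) ∈ Z} = 0 := fun x => by
    refine Countable.measure_zero ?_ _
    refine ((hf.countable_zeros_line hs hc ha hfa (x - a)).preimage
      Complex.ofReal_injective).mono fun t ht => ?_
    simpa [hZ] using ht
  have hT : MeasurableSet {p : E × ℝ | a + p.2 • (p.1 - a) ∈ Z} := by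
    have : Measurable fun p : E × ℝ => a + p.2 • (p.1 - a) :=
      Continuous.measurable (by fun_prop)
    exact this hZm
  have h1 : (μ.prod volume) {p : E × ℝ | a + p.2 • (p.1 - a) ∈ Z} = 0 :=
    (Measure.measure_prod_null hT).2 (.of_forall fun x => hline x)
  have h2 : (volume.prod μ) (Prod.swap ⁻¹' {p : E × ℝ | a + p.2 • (p.1 - a) ∈ Z}) = 0 := by
    rw [(Measure.measurePreserving_swap).measure_preimage hT.nullMeasurableSet, h1]
  have h3 := Measure.measure_ae_null_of_prod_null h2
  obtain ⟨t, ht, ht0⟩ := (h3.and (Measure.ae_ne volume (0 : ℝ))).exists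
  have h4 : Prod.mk t ⁻¹' (Prod.swap ⁻¹' {p : E × ℝ | a + p.2 • (p.1 - a) ∈ Z})
      = (fun x => x + -a) ⁻¹' ((t • ·) ⁻¹' ((fun x => a + x) ⁻¹' Z)) := by
    ext x; simp [sub_eq_add_neg]
  change μ (Prod.mk t ⁻¹' (Prod.swap ⁻¹' {p : E × ℝ | a + p.2 • (p.1 - a) ∈ Z})) = 0 at ht
  rw [h4, measure_preimage_add_right, Measure.addHaar_preimage_smul μ ht0,
    measure_preimage_add] at ht
  simpa [ht0] using ht

open Metric in
/-- The zero set of a holomorphic function that does not vanish identically is a null set. -/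
theorem DifferentiableOn.measure_zeros_eq_zero (μ : Measure E) [μ.IsAddHaarMeasure]
    {Ω : Set E} (hΩ : IsOpen Ω) (hc : IsPreconnected Ω) {f : E → ℂ}
    (hf : DifferentiableOn ℂ f Ω) {z : E} (hz : z ∈ Ω) (hfz : f z ≠ 0) :
    μ {x ∈ Ω | f x = 0} = 0 := by
  have : ProperSpace E := FiniteDimensional.proper ℂ E
  refine measure_null_of_locally_null _ fun x hx => ?_
  obtain ⟨r, hr, hrΩ⟩ := isOpen_iff.1 hΩ x hx.1
  obtain ⟨a, ha, hfa⟩ : ∃ a ∈ ball x r, f a ≠ 0 := by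
    by_contra! hcon
    exact hfz (hf.eqOn_zero_of_isPreconnected hΩ hc hx.1
      (Filter.mem_of_superset (ball_mem_nhds x hr) hcon) hz)
  refine ⟨{y ∈ ball x r | f y = 0}, ?_,
    (hf.mono hrΩ).measure_zeros_eq_zero_of_convex μ isOpen_ball (convex_ball x r) ha hfa⟩
  filter_upwards [self_mem_nhdsWithin, mem_nhdsWithin_of_mem_nhds (ball_mem_nhds x hr)]
    with y hy hyB using ⟨hyB, hy.2⟩

end NullSet

/-! ### Mean value property on balls. -/

section MeanValue

variable {n : ℕ}

open Metric in
theorem setIntegral_closedBall_zero_comp_smul (f : EuclideanSpace ℂ (Fin n) → ℂ) (r : ℝ) {c : ℂ}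
    (hc : ‖c‖ = 1) : ∫ y in closedBall 0 r, f (c • y) = ∫ y in closedBall 0 r, f y := by
  have hc0 : c ≠ 0 := by rintro rfl; simp at hc
  let e : EuclideanSpace ℂ (Fin n) ≃ₗᵢ[ℝ] EuclideanSpace ℂ (Fin n) :=
    { (LinearEquiv.smulOfNeZero ℂ (EuclideanSpace ℂ (Fin n)) c hc0).restrictScalars ℝ with
      norm_map' := fun y => by simp [norm_smul, hc] }
  have h := e.measurePreserving.setIntegral_preimage_emb
    e.toHomeomorph.measurableEmbedding f (closedBall 0 r)
  have he : ∀ y, e y = c • y := fun y => rfl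
  have hpre : e ⁻¹' closedBall 0 r = closedBall 0 r := by
    ext y; simp
  rw [hpre] at h
  simpa only [he] using h

open Metric in
/-- The mean value property of holomorphic functions on balls. -/
theorem DifferentiableOn.setIntegral_closedBall_eq {s : Set (EuclideanSpace ℂ (Fin n))}
    {f : EuclideanSpace ℂ (Fin n) → ℂ} (hf : DifferentiableOn ℂ f s)
    {x : EuclideanSpace ℂ (Fin n)} {r : ℝ} (hB : closedBall x r ⊆ s) :
    ∫ y in closedBall x r, f y = volume.real (closedBall x r) • f x := by
  have hmem : ∀ y ∈ closedBall (0 : EuclideanSpace ℂ (Fin n)) r, ∀ t : ℂ, ‖t‖ ≤ 1 →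
      x + t • y ∈ s := fun y hy t ht => hB (by
    rw [mem_closedBall_zero_iff] at hy
    rw [mem_closedBall, dist_eq_norm, add_sub_cancel_left, norm_smul]
    exact (mul_le_of_le_one_left (norm_nonneg _) ht).trans hy)
  have hnorm : ∀ θ : ℝ, ‖circleMap 0 1 θ‖ = 1 := fun θ => by simp
  have hcircle : ∀ y ∈ closedBall (0 : EuclideanSpace ℂ (Fin n)) r,
      ∫ θ in (0 : ℝ)..2 * Real.pi, f (x + circleMap 0 1 θ • y) = (2 * Real.pi) • f x := by
    intro y hy
    have hd : DiffContOnCl ℂ (fun t : ℂ => f (x + t • y)) (ball 0 |1|) := by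
      have h1 : DifferentiableOn ℂ (fun t : ℂ => f (x + t • y)) (closedBall 0 1) :=
        hf.comp (by fun_prop) fun t ht => hmem y hy t (by simpa using ht)
      rw [abs_one]
      exact h1.diffContOnCl_ball subset_rfl
    have := hd.circleAverage
    rw [Real.circleAverage_def, inv_smul_eq_iff₀ (by positivity)] at this
    simpa using this
  have htrans : ∫ y in closedBall x r, f y = ∫ y in closedBall 0 r, f (x + y) := by
    have h := (measurePreserving_add_left (volume : Measure (EuclideanSpace ℂ (Fin n)))
      x).setIntegral_preimage_emb (measurableEmbedding_addLeft x) f (closedBall x r)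
    rw [← h]
    congr 2
    ext y; simp
  have hvol : volume.real (closedBall x r)
      = volume.real (closedBall (0 : EuclideanSpace ℂ (Fin n)) r) := by
    simp [Measure.real, Measure.addHaar_closedBall_center]
  have hint : Integrable (Function.uncurry fun (θ : ℝ) (y : EuclideanSpace ℂ (Fin n)) =>
      f (x + circleMap 0 1 θ • y))
      ((volume.restrict (Ioc 0 (2 * Real.pi))).prod (volume.restrict (closedBall 0 r))) := by
    rw [Measure.prod_restrict]
    have hcont : ContinuousOn (Function.uncurry fun (θ : ℝ) (y : EuclideanSpace ℂ (Fin n)) =>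
        f (x + circleMap 0 1 θ • y)) (Icc 0 (2 * Real.pi) ×ˢ closedBall 0 r) := by
      refine hf.continuousOn.comp (f := fun p : ℝ × EuclideanSpace ℂ (Fin n) =>
        x + circleMap 0 1 p.1 • p.2) (Continuous.continuousOn ?_) fun p hp =>
          hmem p.2 hp.2 _ (hnorm p.1).le
      have := continuous_circleMap 0 1
      fun_prop
    exact (hcont.integrableOn_compact (isCompact_Icc.prod (isCompact_closedBall 0 r))).mono_set
      (prod_mono_left Ioc_subset_Icc_self)
  -- Integrating over y first gives a constant in θ by rotation invariance; integrating over θ first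
  -- gives 2π f(x) by the one-variable mean value property.
  have hswap := integral_integral_swap hint
  have h1 : ∀ θ : ℝ, ∫ y in closedBall 0 r, f (x + circleMap 0 1 θ • y)
      = ∫ y in closedBall 0 r, f (x + y) := fun θ =>
    setIntegral_closedBall_zero_comp_smul (fun y => f (x + y)) r (hnorm θ)
  simp only [h1] at hswap
  have h2 : ∫ y in closedBall (0 : EuclideanSpace ℂ (Fin n)) r,
      ∫ θ in Ioc 0 (2 * Real.pi), f (x + circleMap 0 1 θ • y)
      = ∫ y in closedBall (0 : EuclideanSpace ℂ (Fin n)) r, (2 * Real.pi) • f x := by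
    refine setIntegral_congr_fun measurableSet_closedBall fun y hy => ?_
    have := hcircle y hy
    rwa [intervalIntegral.integral_of_le Real.two_pi_pos.le] at this
  rw [h2, setIntegral_const, setIntegral_const, smul_comm, Real.volume_real_Ioc_of_le
    Real.two_pi_pos.le, sub_zero] at hswap
  rw [htrans, hvol]
  exact smul_right_injective ℂ (r := 2 * Real.pi) (by positivity) hswap

open Metric in
theorem DifferentiableOn.norm_mul_volume_le {s : Set (EuclideanSpace ℂ (Fin n))}
    {f : EuclideanSpace ℂ (Fin n) → ℂ} (hf : DifferentiableOn ℂ f s)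
    {x : EuclideanSpace ℂ (Fin n)} {r : ℝ} (hB : closedBall x r ⊆ s) :
    ‖f x‖ * volume.real (closedBall x r) ≤ ∫ y in closedBall x r, ‖f y‖ := by
  have h := hf.setIntegral_closedBall_eq hB
  have h1 := norm_integral_le_integral_norm (μ := volume.restrict (closedBall x r)) f
  rw [h, norm_smul, Real.norm_of_nonneg measureReal_nonneg] at h1
  linarith

open Metric in
-- Im f has mean Im f(x) on the ball, and its variance is nonnegative.
theorem DifferentiableOn.sq_im_mul_volume_le {s : Set (EuclideanSpace ℂ (Fin n))}
    {f : EuclideanSpace ℂ (Fin n) → ℂ} (hf : DifferentiableOn ℂ f s)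
    {x : EuclideanSpace ℂ (Fin n)} {r : ℝ} (hB : closedBall x r ⊆ s) :
    (f x).im ^ 2 * volume.real (closedBall x r) ≤ ∫ y in closedBall x r, (f y).im ^ 2 := by
  have hcont : ContinuousOn f (closedBall x r) := hf.continuousOn.mono hB
  have hK := isCompact_closedBall x r
  have hi : IntegrableOn f (closedBall x r) := hcont.integrableOn_compact hK
  have him : ContinuousOn (fun y => (f y).im) (closedBall x r) :=
    Complex.continuous_im.comp_continuousOn hcont
  have h := hf.setIntegral_closedBall_eq hB
  have h1 : ∫ y in closedBall x r, (f y).im = volume.real (closedBall x r) * (f x).im := by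
    have := congrArg Complex.im h
    rw [Complex.smul_im, smul_eq_mul] at this
    rw [← this]
    exact integral_im (𝕜 := ℂ) hi
  have h2 : 0 ≤ ∫ y in closedBall x r, ((f y).im - (f x).im) ^ 2 :=
    integral_nonneg fun y => sq_nonneg _
  have hi1 : IntegrableOn (fun y => (f y).im ^ 2) (closedBall x r) :=
    (him.pow 2).integrableOn_compact hK
  have hi2 : IntegrableOn (fun y => 2 * (f x).im * (f y).im) (closedBall x r) :=
    (continuousOn_const.mul him).integrableOn_compact hK
  have hi3 : IntegrableOn (fun _ => (f x).im ^ 2) (closedBall x r) :=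
    continuousOn_const.integrableOn_compact hK
  have hi12 : IntegrableOn (fun y => (f y).im ^ 2 - 2 * (f x).im * (f y).im) (closedBall x r) :=
    hi1.sub hi2
  have h3 : ∀ y, ((f y).im - (f x).im) ^ 2
      = (f y).im ^ 2 - 2 * (f x).im * (f y).im + (f x).im ^ 2 := fun y => by ring
  simp only [h3] at h2
  rw [integral_add hi12 hi3, integral_sub hi1 hi2, integral_const_mul, h1,
    setIntegral_const, smul_eq_mul] at h2
  nlinarith

end MeanValue

/-! ### Montel's theorem. -/

open Metric Filter in
/-- Montel's theorem: a locally bounded sequence of holomorphic functions has a subsequence that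
converges pointwise to a holomorphic function. -/
theorem exists_subseq_tendsto_differentiableOn {E : Type*} [NormedAddCommGroup E]
    [NormedSpace ℂ E] [FiniteDimensional ℂ E] {Ω : Set E} {F : ℕ → E → ℂ}
    (hF : ∀ j, DifferentiableOn ℂ (F j) Ω)
    (hb : ∀ x ∈ Ω, ∃ R > 0, ball x R ⊆ Ω ∧ ∃ M, ∀ j, ∀ y ∈ ball x R, ‖F j y‖ ≤ M) :
    ∃ (f : E → ℂ) (φ : ℕ → ℕ), StrictMono φ ∧ DifferentiableOn ℂ f Ω ∧
      ∀ x ∈ Ω, Tendsto (fun j => F (φ j) x) atTop (𝓝 (f x)) := by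
  have : ProperSpace E := FiniteDimensional.proper ℂ E
  obtain ⟨D, hDc, hDd⟩ := TopologicalSpace.exists_countable_dense E
  choose! R hR hRΩ M hM using hb
  have : Countable {d : E // d ∈ D ∧ d ∈ Ω} := (hDc.mono fun d hd => hd.1 :
    {d : E | d ∈ D ∧ d ∈ Ω}.Countable).to_subtype
  -- Compactness of a countable product of discs plays the role of the diagonal argument; the local
  -- Lipschitz bounds then carry convergence from the dense set to Ω.
  have hcomp : IsCompact (Set.pi univ fun d : {d : E // d ∈ D ∧ d ∈ Ω} =>
      closedBall (0 : ℂ) (M d)) := isCompact_univ_pi fun d => isCompact_closedBall _ _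
  obtain ⟨a, -, φ, hφ, ha⟩ := hcomp.tendsto_subseq
    (x := fun j (d : {d : E // d ∈ D ∧ d ∈ Ω}) => F j d) fun j d _ => by
      simpa using hM d d.2.2 j d (mem_ball_self (hR d d.2.2))
  rw [tendsto_pi_nhds] at ha
  have hcauchy : ∀ x ∈ Ω, CauchySeq fun j => F (φ j) x := by
    intro x hx
    have hM0 : 0 ≤ M x := (norm_nonneg _).trans (hM x hx 0 x (mem_ball_self (hR x hx)))
    rw [Metric.cauchySeq_iff]
    intro ε hε
    set L := 2 * M x / R x with hL
    have hL0 : 0 ≤ L := div_nonneg (by positivity) (hR x hx).le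
    obtain ⟨d, hd, hdD⟩ := hDd.exists_mem_open (isOpen_ball (x := x)
      (ε := min (R x) (ε / (3 * (L + 1))))) ⟨x, mem_ball_self (lt_min (hR x hx) (by positivity))⟩
    have hdR : d ∈ ball x (R x) := ball_subset_ball (min_le_left _ _) hdD
    have hdε : ‖d - x‖ < ε / (3 * (L + 1)) := by
      rw [← dist_eq_norm]; exact ball_subset_ball (min_le_right _ _) hdD
    have hclose : ∀ j, ‖F j d - F j x‖ < ε / 3 := fun j => by
      calc ‖F j d - F j x‖ ≤ L * ‖d - x‖ :=
            ((hF j).mono (hRΩ x hx)).norm_sub_le_of_norm_le (hM x hx j) hdR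
        _ ≤ (L + 1) * ‖d - x‖ := by gcongr; linarith
        _ < (L + 1) * (ε / (3 * (L + 1))) := by gcongr
        _ = ε / 3 := by field_simp
    obtain ⟨N, hN⟩ := Metric.cauchySeq_iff.1 (ha ⟨d, hd, hRΩ x hx hdR⟩).cauchySeq (ε / 3)
      (by positivity)
    refine ⟨N, fun i hi j hj => ?_⟩
    have h1 := hN i hi j hj
    simp only [Function.comp_apply, dist_eq_norm] at h1 ⊢
    have h2 := hclose (φ i)
    have h3 := hclose (φ j)
    have h4 : F (φ i) x - F (φ j) x = (F (φ i) d - F (φ j) d) - (F (φ i) d - F (φ i) x)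
        + (F (φ j) d - F (φ j) x) := by ring
    rw [h4]
    linarith [norm_add_le ((F (φ i) d - F (φ j) d) - (F (φ i) d - F (φ i) x))
      (F (φ j) d - F (φ j) x), norm_sub_le (F (φ i) d - F (φ j) d) (F (φ i) d - F (φ i) x)]
  have hlim : ∀ x ∈ Ω, ∃ l, Tendsto (fun j => F (φ j) x) atTop (𝓝 l) := fun x hx =>
    cauchySeq_tendsto_of_complete (hcauchy x hx)
  choose! f hf using hlim
  refine ⟨f, φ, hφ, fun x hx => DifferentiableAt.differentiableWithinAt ?_, hf⟩
  exact differentiableAt_of_tendsto_of_norm_le (hR x hx)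
    (fun j => (hF (φ j)).mono (hRΩ x hx)) (fun j => hM x hx (φ j))
    fun w hw => hf w (hRΩ x hx hw)

/-! ### The space A^1 and existence of minimizers. -/

namespace PBergman

variable {n : ℕ} {Ω : Set (EuclideanSpace ℂ (Fin n))}

theorem pNorm_one (f : EuclideanSpace ℂ (Fin n) → ℂ) :
    pNorm 1 Ω f = ∫ ζ in Ω, ‖f ζ‖ := by
  simp [pNorm]

theorem pNorm_one_nonneg (f : EuclideanSpace ℂ (Fin n) → ℂ) : 0 ≤ pNorm 1 Ω f := by
  rw [pNorm_one]
  exact integral_nonneg fun _ => norm_nonneg _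

theorem mem_bergmanSpace_one (hΩ : IsOpen Ω) {f : EuclideanSpace ℂ (Fin n) → ℂ} :
    f ∈ bergmanSpace 1 Ω ↔ DifferentiableOn ℂ f Ω ∧ IntegrableOn f Ω := by
  simp only [bergmanSpace, mem_ofPred_eq, Real.rpow_one]
  refine and_congr_right fun hd => ?_
  exact integrable_norm_iff (hd.continuousOn.aestronglyMeasurable hΩ.measurableSet)

theorem sub_mem_bergmanSpace_one (hΩ : IsOpen Ω) {f g : EuclideanSpace ℂ (Fin n) → ℂ}
    (hf : f ∈ bergmanSpace 1 Ω) (hg : g ∈ bergmanSpace 1 Ω) :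
    (fun w => f w - g w) ∈ bergmanSpace 1 Ω := by
  rw [mem_bergmanSpace_one hΩ] at *
  exact ⟨hf.1.sub hg.1, hf.2.sub hg.2⟩

theorem mul_const_mem_bergmanSpace_one (hΩ : IsOpen Ω) {f : EuclideanSpace ℂ (Fin n) → ℂ}
    (hf : f ∈ bergmanSpace 1 Ω) (c : ℂ) : (fun w => f w * c) ∈ bergmanSpace 1 Ω := by
  rw [mem_bergmanSpace_one hΩ] at *
  exact ⟨hf.1.mul_const c, hf.2.mul_const c⟩

theorem pNorm_one_mul_const (f : EuclideanSpace ℂ (Fin n) → ℂ) (c : ℂ) :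
    pNorm 1 Ω (fun w => f w * c) = pNorm 1 Ω f * ‖c‖ := by
  simp only [pNorm_one, norm_mul]
  rw [integral_mul_const]

open Metric in
/-- Point evaluations are locally uniformly bounded on the Bergman space. -/
theorem exists_forall_norm_le (hΩ : IsOpen Ω) {K : Set (EuclideanSpace ℂ (Fin n))}
    (hK : IsCompact K) (hKΩ : K ⊆ Ω) :
    ∃ C > 0, ∀ f ∈ bergmanSpace 1 Ω, ∀ x ∈ K, ‖f x‖ ≤ C * pNorm 1 Ω f := by
  obtain ⟨r, hr, hrΩ⟩ := hK.exists_cthickening_subset_open hΩ hKΩ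
  set V := volume.real (closedBall (0 : EuclideanSpace ℂ (Fin n)) r) with hV
  have hVpos : 0 < V := ENNReal.toReal_pos (measure_closedBall_pos _ _ hr).ne'
    measure_closedBall_lt_top.ne
  refine ⟨V⁻¹, by positivity, fun f hf x hx => ?_⟩
  rw [mem_bergmanSpace_one hΩ] at hf
  have hB : closedBall x r ⊆ Ω := (closedBall_subset_cthickening hx r).trans hrΩ
  have h := hf.1.norm_mul_volume_le hB
  have h1 : volume.real (closedBall x r) = V := by
    simp [hV, Measure.real, Measure.addHaar_closedBall_center]
  have h2 : ∫ y in closedBall x r, ‖f y‖ ≤ pNorm 1 Ω f := by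
    rw [pNorm_one]
    exact setIntegral_mono_set hf.2.norm (.of_forall fun _ => norm_nonneg _) hB.eventuallyLE
  rw [h1] at h
  rw [inv_mul_eq_div, le_div_iff₀ hVpos]
  exact h.trans h2

open Metric in
-- Cauchy's estimate covers pairs closer than r; for the others the sup bound suffices since |y-x|/r
-- ≥ 1, so K need not be convex.
theorem exists_forall_norm_sub_le (hΩ : IsOpen Ω) {K : Set (EuclideanSpace ℂ (Fin n))}
    (hK : IsCompact K) (hKΩ : K ⊆ Ω) :
    ∃ C > 0, ∀ f ∈ bergmanSpace 1 Ω, ∀ x ∈ K, ∀ y ∈ K,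
      ‖f y - f x‖ ≤ C * pNorm 1 Ω f * ‖y - x‖ := by
  obtain ⟨r, hr, hrΩ⟩ := hK.exists_cthickening_subset_open hΩ hKΩ
  obtain ⟨C, hC, hCf⟩ := exists_forall_norm_le hΩ hK.cthickening hrΩ
  refine ⟨2 * C / r, by positivity, fun f hf x hx y hy => ?_⟩
  have hsub : ball x r ⊆ cthickening r K :=
    ball_subset_closedBall.trans (closedBall_subset_cthickening hx r)
  have hN := pNorm_one_nonneg (Ω := Ω) f
  by_cases hxy : y ∈ ball x r
  · refine (DifferentiableOn.norm_sub_le_of_norm_le (M := C * pNorm 1 Ω f)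
      (((mem_bergmanSpace_one hΩ).1 hf).1.mono (hsub.trans hrΩ))
      (fun w hw => hCf f hf w (hsub hw)) hxy).trans (le_of_eq ?_)
    ring
  · rw [mem_ball, not_lt, dist_eq_norm] at hxy
    have h1 := hCf f hf x (self_subset_cthickening K hx)
    have h2 := hCf f hf y (self_subset_cthickening K hy)
    calc ‖f y - f x‖ ≤ 2 * C * pNorm 1 Ω f := by linarith [norm_sub_le (f y) (f x)]
      _ = 2 * C / r * pNorm 1 Ω f * r := by field_simp
      _ ≤ _ := by gcongr

theorem const_mem_bergmanSpace_one (hΩ : IsBoundedDomain Ω) (c : ℂ) :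
    (fun _ => c) ∈ bergmanSpace 1 Ω := by
  rw [mem_bergmanSpace_one hΩ.isOpen]
  exact ⟨differentiableOn_const c, integrableOn_const hΩ.isBounded.measure_lt_top.ne⟩

open Metric Filter in
/-- The minimum problem defining `m_1(·, z)` has a solution. -/
theorem exists_isMinimizer_one (hΩ : IsBoundedDomain Ω) {z : EuclideanSpace ℂ (Fin n)}
    (hz : z ∈ Ω) : ∃ f, IsMinimizer 1 Ω z f := by
  set S : Set ℝ := {t | ∃ f ∈ bergmanSpace 1 Ω, f z = 1 ∧ t = pNorm 1 Ω f} with hS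
  have hne : S.Nonempty := ⟨_, fun _ => 1, const_mem_bergmanSpace_one hΩ 1, rfl, rfl⟩
  have hbdd : BddBelow S := ⟨0, by rintro _ ⟨f, -, -, rfl⟩; exact pNorm_one_nonneg f⟩
  have hI0 : 0 ≤ sInf S := le_csInf hne (by rintro _ ⟨f, -, -, rfl⟩; exact pNorm_one_nonneg f)
  have hseq : ∀ j : ℕ, ∃ f ∈ bergmanSpace 1 Ω, f z = 1 ∧ pNorm 1 Ω f < sInf S + 1 / (j + 1) := by
    intro j
    obtain ⟨_, ⟨f, hf, hfz, rfl⟩, hlt⟩ := exists_lt_of_csInf_lt hne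
      (lt_add_of_pos_right (sInf S) (Nat.one_div_pos_of_nat (n := j) (α := ℝ)))
    exact ⟨f, hf, hfz, hlt⟩
  choose F hFmem hFz hFlt using hseq
  have hFd : ∀ j, DifferentiableOn ℂ (F j) Ω := fun j =>
    ((mem_bergmanSpace_one hΩ.isOpen).1 (hFmem j)).1
  have hFi : ∀ j, IntegrableOn (F j) Ω := fun j =>
    ((mem_bergmanSpace_one hΩ.isOpen).1 (hFmem j)).2
  have hFle : ∀ j, pNorm 1 Ω (F j) ≤ sInf S + 1 := fun j => by
    refine (hFlt j).le.trans ?_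
    gcongr
    rw [div_le_one (by positivity)]
    linarith [Nat.cast_nonneg (α := ℝ) j]
  obtain ⟨f, φ, hφ, hfd, hlim⟩ := exists_subseq_tendsto_differentiableOn hFd fun x hx => by
    obtain ⟨R, hR, hRΩ⟩ := nhds_basis_closedBall.mem_iff.1 (hΩ.isOpen.mem_nhds hx)
    obtain ⟨C, hC, hCf⟩ := exists_forall_norm_le hΩ.isOpen (isCompact_closedBall x R) hRΩ
    refine ⟨R, hR, ball_subset_closedBall.trans hRΩ, C * (sInf S + 1), fun j y hy => ?_⟩
    exact (hCf _ (hFmem j) y (ball_subset_closedBall hy)).trans (by gcongr; exact hFle j)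
  have hmeas : ∀ g : EuclideanSpace ℂ (Fin n) → ℂ, DifferentiableOn ℂ g Ω →
      AEStronglyMeasurable g (volume.restrict Ω) := fun g hg =>
    hg.continuousOn.aestronglyMeasurable hΩ.isOpen.measurableSet
  -- Fatou: the L¹ norm is lower semicontinuous along the minimizing subsequence.
  have hfatou : ∫⁻ x in Ω, ‖f x‖ₑ ≤ ENNReal.ofReal (sInf S) := by
    have h1 : eLpNorm f 1 (volume.restrict Ω)
        ≤ liminf (fun j => eLpNorm (F (φ j)) 1 (volume.restrict Ω)) atTop :=
      Lp.eLpNorm_lim_le_liminf_eLpNorm (fun j => hmeas _ (hFd (φ j))) f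
        (ae_restrict_of_forall_mem hΩ.isOpen.measurableSet hlim)
    simp only [eLpNorm_one_eq_lintegral_enorm] at h1
    refine h1.trans ?_
    have h2 : Tendsto (fun j => ENNReal.ofReal (sInf S + 1 / ((φ j : ℝ) + 1))) atTop
        (𝓝 (ENNReal.ofReal (sInf S))) := by
      refine (ENNReal.continuous_ofReal.tendsto _).comp ?_
      have h3 := (tendsto_one_div_add_atTop_nhds_zero_nat (𝕜 := ℝ)).comp hφ.tendsto_atTop
      simpa [Function.comp_def] using h3.const_add (sInf S)
    rw [← h2.liminf_eq]
    refine liminf_le_liminf (.of_forall fun j => ?_)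
    change ∫⁻ x in Ω, ‖F (φ j) x‖ₑ ≤ _
    rw [← ofReal_integral_norm_eq_lintegral_enorm (hFi (φ j)), ← pNorm_one]
    exact ENNReal.ofReal_le_ofReal (hFlt _).le
  have hfi : IntegrableOn f Ω := ⟨hmeas f hfd, hfatou.trans_lt ENNReal.ofReal_lt_top⟩
  refine ⟨f, (mem_bergmanSpace_one hΩ.isOpen).2 ⟨hfd, hfi⟩, ?_, fun g hg hgz => ?_⟩
  · refine tendsto_nhds_unique (hlim z hz) ?_
    simp only [hFz]
    exact tendsto_const_nhds
  · refine le_trans ?_ (csInf_le hbdd ⟨g, hg, hgz, rfl⟩)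
    rw [← ofReal_integral_norm_eq_lintegral_enorm hfi, ← pNorm_one] at hfatou
    exact (ENNReal.ofReal_le_ofReal_iff hI0).1 hfatou

end PBergman

/-! ### First variation, reproducing formula and the integral of the deficit. -/

namespace PBergman

variable {n : ℕ} {Ω : Set (EuclideanSpace ℂ (Fin n))} {z z' : EuclideanSpace ℂ (Fin n)}
  {m f : EuclideanSpace ℂ (Fin n) → ℂ}

theorem _root_.Complex.hasDerivAt_norm_add_mul {a : ℂ} (ha : a ≠ 0) (b : ℂ) :
    HasDerivAt (fun t : ℝ => ‖a + t * b‖) ((starRingEnd ℂ a * b).re / ‖a‖) 0 := by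
  have h1 : HasDerivAt (fun t : ℝ => a + t * b) b 0 := by
    simpa using ((Complex.ofRealCLM.hasDerivAt (x := (0 : ℝ))).mul_const b).const_add a
  have h2 := h1.norm_sq.sqrt (by simpa using ha)
  simp only [Real.sqrt_sq (norm_nonneg _), Complex.ofReal_zero, zero_mul, add_zero] at h2
  convert h2 using 1
  rw [Complex.inner]
  field_simp

theorem aestronglyMeasurable_re_conj_mul_div (hΩ : IsOpen Ω) {g : EuclideanSpace ℂ (Fin n) → ℂ}
    (hm : ContinuousOn m Ω) (hg : ContinuousOn g Ω) :
    AEStronglyMeasurable (fun w => (starRingEnd ℂ (m w) * g w).re / ‖m w‖)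
      (volume.restrict Ω) := by
  have h1 : ContinuousOn (fun w => (starRingEnd ℂ (m w) * g w).re) Ω :=
    Complex.continuous_re.comp_continuousOn
      ((Complex.continuous_conj.comp_continuousOn hm).mul hg)
  exact ((h1.aestronglyMeasurable hΩ.measurableSet).aemeasurable.div
    (hm.norm.aestronglyMeasurable hΩ.measurableSet).aemeasurable).aestronglyMeasurable

theorem _root_.Complex.abs_re_conj_mul_div_le (a b : ℂ) :
    |(starRingEnd ℂ a * b).re / ‖a‖| ≤ ‖b‖ := by
  rw [abs_div, abs_norm]
  refine div_le_of_le_mul₀ (norm_nonneg _) (norm_nonneg _) ?_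
  refine (Complex.abs_re_le_norm _).trans (le_of_eq ?_)
  rw [norm_mul, RCLike.norm_conj, mul_comm]

theorem integrableOn_re_conj_mul_div (hΩ : IsOpen Ω) {g : EuclideanSpace ℂ (Fin n) → ℂ}
    (hm : m ∈ bergmanSpace 1 Ω) (hg : g ∈ bergmanSpace 1 Ω) :
    IntegrableOn (fun w => (starRingEnd ℂ (m w) * g w).re / ‖m w‖) Ω := by
  rw [mem_bergmanSpace_one hΩ] at hm hg
  refine hg.2.norm.mono'
    (aestronglyMeasurable_re_conj_mul_div hΩ hm.1.continuousOn hg.1.continuousOn)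
    (.of_forall fun w => ?_)
  exact Complex.abs_re_conj_mul_div_le _ _

/-- Each m + tg is a competitor, so t ↦ ‖m + tg‖_1 is minimal at 0. Differentiation under the
integral is allowed because |m + tg| is |g|-Lipschitz in t and differentiable at 0 where m ≠ 0, that
is, almost everywhere. -/
theorem IsMinimizer.integral_eq_zero (hΩ : IsBoundedDomain Ω) (hz : z ∈ Ω)
    (hm : IsMinimizer 1 Ω z m) {g : EuclideanSpace ℂ (Fin n) → ℂ} (hg : g ∈ bergmanSpace 1 Ω)
    (hgz : g z = 0) : ∫ w in Ω, (starRingEnd ℂ (m w) * g w).re / ‖m w‖ = 0 := by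
  have hmA := (mem_bergmanSpace_one hΩ.isOpen).1 hm.mem
  have hgA := (mem_bergmanSpace_one hΩ.isOpen).1 hg
  have hmem : ∀ t : ℝ, (fun w => m w + t * g w) ∈ bergmanSpace 1 Ω := fun t =>
    (mem_bergmanSpace_one hΩ.isOpen).2
      ⟨hmA.1.add (hgA.1.const_mul _), hmA.2.add (hgA.2.const_mul _)⟩
  have hnull : ∀ᵐ w ∂(volume.restrict Ω), m w ≠ 0 := by
    rw [ae_restrict_iff' hΩ.isOpen.measurableSet, ae_iff]
    have := hmA.1.measure_zeros_eq_zero volume hΩ.isOpen hΩ.isConnected.isPreconnected hz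
      (by rw [hm.apply_eq_one]; exact one_ne_zero)
    simpa using this
  have hderiv := (hasDerivAt_integral_of_dominated_loc_of_lip (μ := volume.restrict Ω)
    (F := fun (t : ℝ) w => ‖m w + t * g w‖) (x₀ := 0) (bound := fun w => ‖g w‖)
    (F' := fun w => (starRingEnd ℂ (m w) * g w).re / ‖m w‖) (s := univ) Filter.univ_mem
    (.of_forall fun t => ((mem_bergmanSpace_one hΩ.isOpen).1
      (hmem t)).2.norm.aestronglyMeasurable)
    ((mem_bergmanSpace_one hΩ.isOpen).1 (hmem 0)).2.norm
    (aestronglyMeasurable_re_conj_mul_div hΩ.isOpen hmA.1.continuousOn hgA.1.continuousOn)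
    (.of_forall fun w => LipschitzOnWith.of_dist_le_mul fun t _ s _ => by
      rw [Real.dist_eq, Real.dist_eq, Real.coe_nnabs, abs_norm]
      refine (abs_norm_sub_norm_le _ _).trans (le_of_eq ?_)
      have : m w + t * g w - (m w + s * g w) = ((t - s : ℝ) : ℂ) * g w := by
        push_cast; ring
      rw [this, norm_mul, Complex.norm_real, Real.norm_eq_abs, mul_comm])
    hgA.2.norm (hnull.mono fun w hw => Complex.hasDerivAt_norm_add_mul hw (g w))).2
  refine IsLocalMin.hasDerivAt_eq_zero (.of_forall fun t => ?_) hderiv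
  have h1 := hm.le _ (hmem t) (by simp [hm.apply_eq_one, hgz])
  simpa [pNorm_one] using h1

theorem IsMinimizer.pNorm_pos (hΩ : IsBoundedDomain Ω) (hz : z ∈ Ω) (hm : IsMinimizer 1 Ω z m) :
    0 < pNorm 1 Ω m := by
  obtain ⟨C, hC, h⟩ := exists_forall_norm_le hΩ.isOpen (isCompact_singleton (x := z))
    (singleton_subset_iff.2 hz)
  have := h m hm.mem z rfl
  rw [hm.apply_eq_one, norm_one] at this
  exact pos_of_mul_pos_right (zero_lt_one.trans_le this) hC.le

/-- The first variation applies to f - f(z)m, which vanishes at z. -/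
theorem IsMinimizer.integral_eq (hΩ : IsBoundedDomain Ω) (hz : z ∈ Ω)
    (hm : IsMinimizer 1 Ω z m) (hf : f ∈ bergmanSpace 1 Ω) :
    ∫ w in Ω, (starRingEnd ℂ (m w) * f w).re / ‖m w‖ = (f z).re * pNorm 1 Ω m := by
  have hmf := mul_const_mem_bergmanSpace_one hΩ.isOpen hm.mem (f z)
  have h := hm.integral_eq_zero hΩ hz (sub_mem_bergmanSpace_one hΩ.isOpen hf hmf)
    (by simp [hm.apply_eq_one])
  have h1 : ∀ w, (starRingEnd ℂ (m w) * (f w - m w * f z)).re / ‖m w‖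
      = (starRingEnd ℂ (m w) * f w).re / ‖m w‖ - ‖m w‖ * (f z).re := fun w => by
    have h2 : starRingEnd ℂ (m w) * (f w - m w * f z)
        = starRingEnd ℂ (m w) * f w - ((‖m w‖ ^ 2 : ℝ) : ℂ) * f z := by
      rw [mul_sub, ← mul_assoc, ← Complex.normSq_eq_conj_mul_self, Complex.normSq_eq_norm_sq]
    rw [h2, Complex.sub_re, Complex.re_ofReal_mul, sub_div]
    congr 1
    -- At zeros of m the quotient is 0 by convention, so the identity holds at every w.
    rcases eq_or_ne ‖m w‖ 0 with h0 | h0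
    · simp [h0]
    · field_simp
  simp only [h1] at h
  rw [integral_sub (integrableOn_re_conj_mul_div hΩ.isOpen hm.mem hf)
    (((mem_bergmanSpace_one hΩ.isOpen).1 hm.mem).2.norm.mul_const _), integral_mul_const,
    ← pNorm_one] at h
  linarith

theorem IsMinimizer.norm_apply_mul_le (hΩ : IsBoundedDomain Ω) (hm : IsMinimizer 1 Ω z m)
    (hf : f ∈ bergmanSpace 1 Ω) : ‖f z‖ * pNorm 1 Ω m ≤ pNorm 1 Ω f := by
  rcases eq_or_ne (f z) 0 with h0 | h0
  · simpa [h0] using pNorm_one_nonneg f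
  · have h := hm.le _ (mul_const_mem_bergmanSpace_one hΩ.isOpen hf (f z)⁻¹)
      (mul_inv_cancel₀ h0)
    rwa [pNorm_one_mul_const, norm_inv, ← div_eq_mul_inv, le_div_iff₀ (norm_pos_iff.2 h0),
      mul_comm] at h

theorem IsMinimizer.diagKernel_eq (hΩ : IsBoundedDomain Ω) (hz : z ∈ Ω)
    (hm : IsMinimizer 1 Ω z m) : diagKernel 1 Ω z = (pNorm 1 Ω m)⁻¹ := by
  have hpos := hm.pNorm_pos hΩ hz
  refine IsGreatest.csSup_eq ⟨⟨fun w => m w * ((pNorm 1 Ω m)⁻¹ : ℝ),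
    mul_const_mem_bergmanSpace_one hΩ.isOpen hm.mem _, ?_, ?_⟩, ?_⟩
  · rw [pNorm_one_mul_const, Complex.norm_real, norm_inv, Real.norm_of_nonneg hpos.le,
      mul_inv_cancel₀ hpos.ne']
  · dsimp only
    rw [hm.apply_eq_one, one_mul, Complex.norm_real, Real.rpow_one, norm_inv,
      Real.norm_of_nonneg hpos.le]
  · rintro _ ⟨f, hf, hf1, rfl⟩
    rw [Real.rpow_one, ← one_div, le_div_iff₀ hpos]
    exact (hm.norm_apply_mul_le hΩ hf).trans_eq hf1

theorem isMinimizer_minimizer_one (hΩ : IsBoundedDomain Ω) (hz : z ∈ Ω) :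
    IsMinimizer 1 Ω z fun w => minimizer 1 Ω w z := by
  have h := exists_isMinimizer_one hΩ hz
  simp only [minimizer, dif_pos h]
  exact h.choose_spec

theorem diagKernel_one_pos (hΩ : IsBoundedDomain Ω) (hz : z ∈ Ω) : 0 < diagKernel 1 Ω z := by
  have hm := isMinimizer_minimizer_one hΩ hz
  rw [hm.diagKernel_eq hΩ hz]
  exact inv_pos.2 (hm.pNorm_pos hΩ hz)

theorem norm_apply_le_diagKernel (hΩ : IsBoundedDomain Ω) (hz : z ∈ Ω)
    (hf : f ∈ bergmanSpace 1 Ω) : ‖f z‖ ≤ diagKernel 1 Ω z * pNorm 1 Ω f := by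
  have hm := isMinimizer_minimizer_one hΩ hz
  rw [hm.diagKernel_eq hΩ hz, inv_mul_eq_div, le_div_iff₀ (hm.pNorm_pos hΩ hz)]
  exact hm.norm_apply_mul_le hΩ hf

theorem bergmanKernel_one_self (hΩ : IsBoundedDomain Ω) (hz : z ∈ Ω) :
    bergmanKernel 1 Ω z z = diagKernel 1 Ω z := by
  rw [bergmanKernel, (isMinimizer_minimizer_one hΩ hz).apply_eq_one, one_mul]

theorem bergmanKernel_one_mem (hΩ : IsBoundedDomain Ω) (hz : z ∈ Ω) :
    (fun w => bergmanKernel 1 Ω w z) ∈ bergmanSpace 1 Ω :=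
  mul_const_mem_bergmanSpace_one hΩ.isOpen (isMinimizer_minimizer_one hΩ hz).mem _

theorem pNorm_bergmanKernel_one (hΩ : IsBoundedDomain Ω) (hz : z ∈ Ω) :
    pNorm 1 Ω (fun w => bergmanKernel 1 Ω w z) = 1 := by
  have hm := isMinimizer_minimizer_one hΩ hz
  have hpos := hm.pNorm_pos hΩ hz
  simp only [bergmanKernel]
  rw [pNorm_one_mul_const, Complex.norm_real, Real.norm_of_nonneg (diagKernel_one_pos hΩ hz).le,
    hm.diagKernel_eq hΩ hz, mul_inv_cancel₀ hpos.ne']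

/-- The reproducing property of the kernel `K_1(·, z)`. -/
theorem integral_re_conj_bergmanKernel_mul_div (hΩ : IsBoundedDomain Ω) (hz : z ∈ Ω)
    (hf : f ∈ bergmanSpace 1 Ω) :
    ∫ w in Ω, (starRingEnd ℂ (bergmanKernel 1 Ω w z) * f w).re / ‖bergmanKernel 1 Ω w z‖
      = (f z).re / diagKernel 1 Ω z := by
  have hm := isMinimizer_minimizer_one hΩ hz
  have hK := diagKernel_one_pos hΩ hz
  have h := hm.integral_eq hΩ hz hf
  rw [div_eq_mul_inv, hm.diagKernel_eq hΩ hz, inv_inv, ← h]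
  congr 1
  ext w
  rw [bergmanKernel, map_mul, Complex.conj_ofReal, norm_mul, Complex.norm_real,
    Real.norm_of_nonneg hK.le, mul_right_comm, Complex.re_mul_ofReal, mul_div_mul_right _ _ hK.ne']

/-- The reproducing formula makes the integral equal to the first term on the right. The subtracted
term is nonpositive since |K_1(z',z)| ≤ K_1(z'); including it produces a difference between z and
z', the source of the factor |z-z'|. -/
theorem integral_norm_sub_re_conj_mul_div_le (hΩ : IsBoundedDomain Ω) (hz : z ∈ Ω)
    (hz' : z' ∈ Ω) :
    ∫ w in Ω, (‖bergmanKernel 1 Ω w z'‖ -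
        (starRingEnd ℂ (bergmanKernel 1 Ω w z) * bergmanKernel 1 Ω w z').re
          / ‖bergmanKernel 1 Ω w z‖)
      ≤ (bergmanKernel 1 Ω z z - bergmanKernel 1 Ω z z').re / diagKernel 1 Ω z
        - (bergmanKernel 1 Ω z' z - bergmanKernel 1 Ω z' z').re / diagKernel 1 Ω z' := by
  have hk := bergmanKernel_one_mem hΩ hz
  have hk' := bergmanKernel_one_mem hΩ hz'
  have hK := diagKernel_one_pos hΩ hz
  have hK' := diagKernel_one_pos hΩ hz'
  rw [integral_sub ((mem_bergmanSpace_one hΩ.isOpen).1 hk').2.norm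
    (integrableOn_re_conj_mul_div hΩ.isOpen hk hk'), ← pNorm_one,
    pNorm_bergmanKernel_one hΩ hz', integral_re_conj_bergmanKernel_mul_div hΩ hz hk',
    bergmanKernel_one_self hΩ hz, bergmanKernel_one_self hΩ hz', Complex.sub_re, Complex.sub_re,
    Complex.ofReal_re, Complex.ofReal_re, sub_div, sub_div, div_self hK.ne', div_self hK'.ne']
  have h1 : (bergmanKernel 1 Ω z' z).re / diagKernel 1 Ω z' ≤ 1 := by
    rw [div_le_one hK']
    have := norm_apply_le_diagKernel hΩ hz' hk
    rw [pNorm_bergmanKernel_one hΩ hz, mul_one] at this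
    exact (Complex.re_le_norm _).trans this
  linarith

/-- K_1(·,z) has norm 1, so it attains the maximum at z and is a competitor at z'. Lipschitz
continuity of K_1 follows. -/
theorem diagKernel_one_sub_le (hΩ : IsBoundedDomain Ω) (hz : z ∈ Ω) (hz' : z' ∈ Ω) :
    diagKernel 1 Ω z - diagKernel 1 Ω z' ≤ ‖bergmanKernel 1 Ω z z - bergmanKernel 1 Ω z' z‖ := by
  have hk := bergmanKernel_one_mem hΩ hz
  have h1 := norm_apply_le_diagKernel hΩ hz' hk
  rw [pNorm_bergmanKernel_one hΩ hz, mul_one] at h1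
  have h2 : ‖bergmanKernel 1 Ω z z‖ = diagKernel 1 Ω z := by
    rw [bergmanKernel_one_self hΩ hz, Complex.norm_real,
      Real.norm_of_nonneg (diagKernel_one_pos hΩ hz).le]
  linarith [norm_sub_norm_le (bergmanKernel 1 Ω z z) (bergmanKernel 1 Ω z' z)]

theorem exists_abs_diagKernel_one_sub_le (hΩ : IsBoundedDomain Ω)
    {L : Set (EuclideanSpace ℂ (Fin n))} (hL : IsCompact L) (hLΩ : L ⊆ Ω) :
    ∃ C > 0, ∀ x ∈ L, ∀ y ∈ L, |diagKernel 1 Ω x - diagKernel 1 Ω y| ≤ C * ‖x - y‖ := by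
  obtain ⟨C, hC, h⟩ := exists_forall_norm_sub_le hΩ.isOpen hL hLΩ
  have key : ∀ x ∈ L, ∀ y ∈ L, diagKernel 1 Ω x - diagKernel 1 Ω y ≤ C * ‖x - y‖ := by
    intro x hx y hy
    have h1 := h _ (bergmanKernel_one_mem hΩ (hLΩ hx)) y hy x hx
    rw [pNorm_bergmanKernel_one hΩ (hLΩ hx), mul_one] at h1
    exact (diagKernel_one_sub_le hΩ (hLΩ hx) (hLΩ hy)).trans h1
  refine ⟨C, hC, fun x hx y hy => abs_le.2 ⟨?_, key x hx y hy⟩⟩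
  have := key y hy x hx
  rw [norm_sub_rev] at this
  linarith

theorem inv_diagKernel_one_le (hΩ : IsBoundedDomain Ω) (hz : z ∈ Ω) :
    (diagKernel 1 Ω z)⁻¹ ≤ pNorm 1 Ω (fun _ => 1) := by
  have := norm_apply_le_diagKernel hΩ hz (const_mem_bergmanSpace_one hΩ 1)
  rw [norm_one] at this
  rwa [inv_le_iff_one_le_mul₀' (diagKernel_one_pos hΩ hz)]

theorem exists_integral_norm_sub_re_conj_mul_div_le (hΩ : IsBoundedDomain Ω)
    {L : Set (EuclideanSpace ℂ (Fin n))} (hL : IsCompact L) (hLΩ : L ⊆ Ω) :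
    ∃ C > 0, ∀ z ∈ L, ∀ z' ∈ L,
      ∫ w in Ω, (‖bergmanKernel 1 Ω w z'‖ -
          (starRingEnd ℂ (bergmanKernel 1 Ω w z) * bergmanKernel 1 Ω w z').re
            / ‖bergmanKernel 1 Ω w z‖)
        ≤ C * (‖z - z'‖ *
          pNorm 1 Ω (fun w => bergmanKernel 1 Ω w z - bergmanKernel 1 Ω w z')) := by
  obtain ⟨C₁, hC₁, h₁⟩ := exists_forall_norm_le hΩ.isOpen hL hLΩ
  obtain ⟨C₂, hC₂, h₂⟩ := exists_forall_norm_sub_le hΩ.isOpen hL hLΩ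
  obtain ⟨C₃, hC₃, h₃⟩ := exists_abs_diagKernel_one_sub_le hΩ hL hLΩ
  set v := pNorm 1 Ω (fun _ => (1 : ℂ)) with hv
  have hv0 : 0 ≤ v := pNorm_one_nonneg _
  -- The first two terms bound h(z)(1/κ - 1/κ') and (h(z) - h(z'))/κ'; the 1 only ensures
  -- positivity.
  refine ⟨C₁ * (v * (C₃ * v)) + C₂ * v + 1, by positivity, fun z hz z' hz' => ?_⟩
  have hK := diagKernel_one_pos hΩ (hLΩ hz)
  have hK' := diagKernel_one_pos hΩ (hLΩ hz')
  have hh := sub_mem_bergmanSpace_one hΩ.isOpen (bergmanKernel_one_mem hΩ (hLΩ hz))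
    (bergmanKernel_one_mem hΩ (hLΩ hz'))
  refine (integral_norm_sub_re_conj_mul_div_le hΩ (hLΩ hz) (hLΩ hz')).trans ?_
  have e₁ := h₁ _ hh z hz
  have e₂ := h₂ _ hh z' hz' z hz
  have e₃ := h₃ z hz z' hz'
  set h : EuclideanSpace ℂ (Fin n) → ℂ :=
    fun w => bergmanKernel 1 Ω w z - bergmanKernel 1 Ω w z' with hdef
  set N := pNorm 1 Ω h with hN
  have hN0 : 0 ≤ N := pNorm_one_nonneg _
  set κ := diagKernel 1 Ω z
  set κ' := diagKernel 1 Ω z'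
  have i₁ : κ⁻¹ ≤ v := inv_diagKernel_one_le hΩ (hLΩ hz)
  have i₂ : κ'⁻¹ ≤ v := inv_diagKernel_one_le hΩ (hLΩ hz')
  have hinv : |κ⁻¹ - κ'⁻¹| ≤ v * (C₃ * ‖z - z'‖ * v) := by
    have : κ⁻¹ - κ'⁻¹ = κ⁻¹ * (-(κ - κ') * κ'⁻¹) := by field_simp; ring
    rw [this, abs_mul, abs_mul, abs_neg, abs_of_pos (inv_pos.2 hK), abs_of_pos (inv_pos.2 hK')]
    gcongr
  have hsplit : (h z).re / κ - (h z').re / κ'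
      = (h z).re * (κ⁻¹ - κ'⁻¹) + (h z - h z').re * κ'⁻¹ := by
    have : (h z - h z').re = (h z).re - (h z').re := Complex.sub_re _ _
    rw [this]; field_simp; ring
  change (h z).re / κ - (h z').re / κ' ≤ _
  rw [hsplit]
  have t₁ : (h z).re * (κ⁻¹ - κ'⁻¹) ≤ C₁ * N * (v * (C₃ * ‖z - z'‖ * v)) := by
    refine (le_abs_self _).trans ?_
    rw [abs_mul]
    gcongr
    exact (Complex.abs_re_le_norm _).trans e₁
  have t₂ : (h z - h z').re * κ'⁻¹ ≤ C₂ * N * ‖z - z'‖ * v := by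
    refine (le_abs_self _).trans ?_
    rw [abs_mul, abs_of_pos (inv_pos.2 hK')]
    gcongr
    exact (Complex.abs_re_le_norm _).trans e₂
  have t₃ : 0 ≤ ‖z - z'‖ * N := by positivity
  linarith

end PBergman

/-! ### From a small deficit to a small oscillation. -/

open Metric in
/-- A holomorphic function with small imaginary part is nearly constant. -/
theorem DifferentiableOn.norm_sub_le_of_abs_im_le {E : Type*} [NormedAddCommGroup E]
    [NormedSpace ℂ E] {f : E → ℂ} {x y : E} {R δ : ℝ} (hf : DifferentiableOn ℂ f (ball x R))
    (hδ : ∀ w ∈ ball x R, |(f w).im| ≤ δ) (hy : y ∈ ball x (R / 2)) :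
    ‖f y - f x‖ ≤ 4 * δ := by
  have hR : 0 < R := by linarith [nonempty_ball.1 ⟨y, hy⟩]
  have hδ0 : 0 ≤ δ := (abs_nonneg _).trans (hδ x (mem_ball_self hR))
  have hmaps : ∀ t ∈ ball (0 : ℂ) 2, x + t • (y - x) ∈ ball x R := fun t ht => by
    rw [mem_ball_zero_iff] at ht
    rw [mem_ball, dist_eq_norm] at hy
    rw [mem_ball, dist_eq_norm, add_sub_cancel_left, norm_smul]
    calc ‖t‖ * ‖y - x‖ ≤ 2 * ‖y - x‖ := by gcongr
      _ < R := by linarith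
  refine le_of_forall_pos_le_add fun ε hε => ?_
  -- Multiplying by -i turns Im f into a real part, at most 2δ after subtracting f(x). Radius 2 and
  -- point 1 give the factor 2; ε/2 keeps the bound positive when δ = 0.
  have key := Complex.borelCaratheodory_zero (M := 2 * δ + ε / 2) (R := 2) (z := 1)
    (f := fun t : ℂ => -Complex.I * (f (x + t • (y - x)) - f x)) (by positivity)
    (((hf.comp (by fun_prop) hmaps).sub_const _).const_mul _) (fun t ht => by
      have h1 := abs_le.1 (hδ _ (hmaps t ht))
      have h2 := abs_le.1 (hδ x (mem_ball_self hR))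
      simp
      linarith) two_pos (by simp) (by simp)
  simp only [one_smul, add_sub_cancel, norm_mul, norm_neg, Complex.norm_I, one_mul, norm_one]
    at key
  refine key.trans (le_of_eq ?_)
  ring

/-- With F = b/a, the deficit is |a|(|F| - Re F), while (Im F)² = (|F| - Re F)(|F| + Re F) and the
last factor is at most 2M/c. -/
theorem Complex.sq_im_div_le {a b : ℂ} {c M : ℝ} (hc : 0 < c) (ha : c ≤ ‖a‖) (hb : ‖b‖ ≤ M) :
    (b / a).im ^ 2 ≤ 2 * M / c ^ 2 * (‖b‖ - (starRingEnd ℂ a * b).re / ‖a‖) := by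
  have ha0 : 0 < ‖a‖ := hc.trans_le ha
  have hne : a ≠ 0 := norm_pos_iff.1 ha0
  have hM : 0 ≤ M := (norm_nonneg _).trans hb
  set F := b / a with hF
  have hbF : b = a * F := by rw [hF]; field_simp
  have hD : ‖b‖ - (starRingEnd ℂ a * b).re / ‖a‖ = ‖a‖ * (‖F‖ - F.re) := by
    have : starRingEnd ℂ a * b = ((‖a‖ ^ 2 : ℝ) : ℂ) * F := by
      rw [hbF, ← mul_assoc, ← Complex.normSq_eq_conj_mul_self, Complex.normSq_eq_norm_sq]
    rw [this, Complex.re_ofReal_mul, hbF, norm_mul]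
    field_simp
  have hre : F.re ≤ ‖F‖ := Complex.re_le_norm F
  have hFM : ‖F‖ ≤ M / c := by
    rw [hF, norm_div]; gcongr
  have h1 : F.im ^ 2 = (‖F‖ - F.re) * (‖F‖ + F.re) := by
    have := Complex.sq_norm F
    rw [Complex.normSq_apply] at this
    nlinarith
  rw [hD, h1]
  calc (‖F‖ - F.re) * (‖F‖ + F.re) ≤ (‖F‖ - F.re) * (2 * (M / c)) := by
        gcongr
        linarith
    _ = 2 * M / c ^ 2 * (c * (‖F‖ - F.re)) := by field_simp
    _ ≤ 2 * M / c ^ 2 * (‖a‖ * (‖F‖ - F.re)) := by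
        gcongr

/-! ### Local oscillation of the quotient and its propagation from z. -/

namespace PBergman

variable {n : ℕ} {Ω : Set (EuclideanSpace ℂ (Fin n))} {z : EuclideanSpace ℂ (Fin n)}

open Metric in
/-- Near a point where `K_1(·, z)` does not vanish, the quotient `K_1(·, z') / K_1(·, z)` has small
oscillation, uniformly in `z'`. -/
theorem exists_norm_div_sub_div_le (hΩ : IsBoundedDomain Ω)
    {L : Set (EuclideanSpace ℂ (Fin n))} (hL : IsCompact L) (hLΩ : L ⊆ Ω) (hz : z ∈ L)
    {x : EuclideanSpace ℂ (Fin n)} (hx : x ∈ Ω) (hxz : bergmanKernel 1 Ω x z ≠ 0) :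
    ∃ r > 0, ∃ C > 0, ∀ z' ∈ L, ∀ y ∈ ball x r,
      ‖bergmanKernel 1 Ω y z' / bergmanKernel 1 Ω y z
        - bergmanKernel 1 Ω x z' / bergmanKernel 1 Ω x z‖
      ≤ C * √(‖z - z'‖ *
          pNorm 1 Ω (fun w => bergmanKernel 1 Ω w z - bergmanKernel 1 Ω w z')) := by
  obtain ⟨C₀, hC₀, hint⟩ := exists_integral_norm_sub_re_conj_mul_div_le hΩ hL hLΩ
  have hk := bergmanKernel_one_mem hΩ (hLΩ hz)
  have hkd := ((mem_bergmanSpace_one hΩ.isOpen).1 hk).1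
  have hGo : IsOpen (Ω ∩ (fun w => bergmanKernel 1 Ω w z) ⁻¹' {0}ᶜ) :=
    hkd.continuousOn.isOpen_inter_preimage hΩ.isOpen isOpen_compl_singleton
  set G := Ω ∩ (fun w => bergmanKernel 1 Ω w z) ⁻¹' {0}ᶜ with hG
  obtain ⟨R', hR', hRG⟩ := nhds_basis_closedBall.mem_iff.1 (hGo.mem_nhds ⟨hx, hxz⟩)
  obtain ⟨R, hR, rfl⟩ : ∃ R > 0, R' = 2 * R := ⟨R' / 2, by positivity, by ring⟩
  have hcomp := isCompact_closedBall x (2 * R)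
  obtain ⟨c, hc, hcle⟩ : ∃ c > 0, ∀ y ∈ closedBall x (2 * R), c ≤ ‖bergmanKernel 1 Ω y z‖ := by
    obtain ⟨y, hy, hmin⟩ := hcomp.exists_isMinOn ⟨x, mem_closedBall_self hR'.le⟩
      (hkd.continuousOn.mono (hRG.trans inter_subset_left)).norm
    exact ⟨_, norm_pos_iff.2 (hRG hy).2, fun w hw => hmin hw⟩
  obtain ⟨M, hM, hMle⟩ := exists_forall_norm_le hΩ.isOpen hcomp (hRG.trans inter_subset_left)
  set V := volume.real (closedBall (0 : EuclideanSpace ℂ (Fin n)) R) with hV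
  have hVpos : 0 < V := ENNReal.toReal_pos (measure_closedBall_pos _ _ hR).ne'
    measure_closedBall_lt_top.ne
  set A := 2 * M / c ^ 2 * C₀ / V with hA
  have hApos : 0 < A := by positivity
  refine ⟨R / 2, by positivity, 4 * √A, by positivity, fun z' hz' y hy => ?_⟩
  have hk' := bergmanKernel_one_mem hΩ (hLΩ hz')
  have hkd' := ((mem_bergmanSpace_one hΩ.isOpen).1 hk').1
  set T := ‖z - z'‖ * pNorm 1 Ω (fun w => bergmanKernel 1 Ω w z - bergmanKernel 1 Ω w z')
    with hT
  set D : EuclideanSpace ℂ (Fin n) → ℝ := fun w => ‖bergmanKernel 1 Ω w z'‖ -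
    (starRingEnd ℂ (bergmanKernel 1 Ω w z) * bergmanKernel 1 Ω w z').re
      / ‖bergmanKernel 1 Ω w z‖ with hD
  have hDi : IntegrableOn D Ω := ((mem_bergmanSpace_one hΩ.isOpen).1 hk').2.norm.sub
    (integrableOn_re_conj_mul_div hΩ.isOpen hk hk')
  have hD0 : ∀ w, 0 ≤ D w := fun w => by
    have := Complex.abs_re_conj_mul_div_le (bergmanKernel 1 Ω w z) (bergmanKernel 1 Ω w z')
    simp only [hD]
    linarith [le_abs_self ((starRingEnd ℂ (bergmanKernel 1 Ω w z) *
      bergmanKernel 1 Ω w z').re / ‖bergmanKernel 1 Ω w z‖)]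
  set F : EuclideanSpace ℂ (Fin n) → ℂ :=
    fun w => bergmanKernel 1 Ω w z' / bergmanKernel 1 Ω w z with hF
  have hFd : DifferentiableOn ℂ F G := by
    have h1 := (hkd'.mono inter_subset_left).mul
      ((hkd.mono inter_subset_left : DifferentiableOn ℂ _ G).inv fun w hw => hw.2)
    exact h1.congr fun w _ => div_eq_mul_inv _ _
  -- Balls of radius R about w stay where |k| ≥ c. There the mean of (Im F)² is controlled by the
  -- mean of D, and D ≥ 0 lets its integral be enlarged to Ω.
  have him : ∀ w ∈ ball x R, |(F w).im| ≤ √A * √T := by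
    intro w hw
    have hB : closedBall w R ⊆ closedBall x (2 * R) := by
      refine closedBall_subset_closedBall' ?_
      rw [mem_ball] at hw
      linarith
    have h1 := (hFd.sq_im_mul_volume_le (hB.trans hRG))
    have h2 : volume.real (closedBall w R) = V := by
      simp [hV, Measure.real, Measure.addHaar_closedBall_center]
    have h3 : ∫ y in closedBall w R, (F y).im ^ 2 ≤ ∫ y in closedBall w R, 2 * M / c ^ 2 * D y := by
      refine setIntegral_mono_on ?_ ?_ measurableSet_closedBall fun y hy => ?_
      · refine ContinuousOn.integrableOn_compact (isCompact_closedBall w R) ?_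
        exact (Complex.continuous_im.comp_continuousOn
          (hFd.continuousOn.mono (hB.trans hRG))).pow 2
      · exact (hDi.mono_set (hB.trans (hRG.trans inter_subset_left))).const_mul _
      · refine Complex.sq_im_div_le hc (hcle y (hB hy)) ?_
        have := hMle _ hk' y (hB hy)
        rwa [pNorm_bergmanKernel_one hΩ (hLΩ hz'), mul_one] at this
    have h4 : ∫ y in closedBall w R, D y ≤ ∫ y in Ω, D y :=
      setIntegral_mono_set hDi (.of_forall hD0)
        (hB.trans (hRG.trans inter_subset_left)).eventuallyLE
    have h5 := hint z hz z' hz'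
    rw [integral_const_mul] at h3
    rw [h2] at h1
    have h6 : (F w).im ^ 2 ≤ A * T := by
      rw [← le_div_iff₀ hVpos] at h1
      refine h1.trans ?_
      calc _ ≤ (2 * M / c ^ 2 * (C₀ * T)) / V := by
            gcongr
            refine h3.trans ?_
            gcongr
            exact h4.trans h5
        _ = A * T := by rw [hA]; ring
    rw [← Real.sqrt_mul hApos.le, ← Real.sqrt_sq_eq_abs]
    exact Real.sqrt_le_sqrt h6
  refine ((hFd.mono ?_).norm_sub_le_of_abs_im_le him hy).trans (le_of_eq (by ring))
  exact (ball_subset_closedBall.trans (closedBall_subset_closedBall (by linarith))).trans hRG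

open Metric Filter in
-- The points near which the bound holds uniformly in z' form an open set containing z and
-- relatively closed off the zeros of k, hence containing that whole connected set. Compactness of L
-- then yields a single constant.
theorem exists_norm_div_sub_one_le (hΩ : IsBoundedDomain Ω)
    {L : Set (EuclideanSpace ℂ (Fin n))} (hL : IsCompact L) (hLΩ : L ⊆ Ω) (hz : z ∈ L)
    (hne : ∀ x ∈ L, bergmanKernel 1 Ω x z ≠ 0) :
    ∃ C > 0, ∀ x ∈ L, ∀ z' ∈ L,
      ‖bergmanKernel 1 Ω x z' / bergmanKernel 1 Ω x z - 1‖ ≤ C * (√(‖z - z'‖ *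
        pNorm 1 Ω (fun w => bergmanKernel 1 Ω w z - bergmanKernel 1 Ω w z')) + ‖z - z'‖) := by
  have hzΩ := hLΩ hz
  set e : EuclideanSpace ℂ (Fin n) → ℝ := fun z' => √(‖z - z'‖ *
    pNorm 1 Ω (fun w => bergmanKernel 1 Ω w z - bergmanKernel 1 Ω w z')) + ‖z - z'‖ with he
  have he0 : ∀ z', 0 ≤ e z' := fun z' => by positivity
  set F : EuclideanSpace ℂ (Fin n) → EuclideanSpace ℂ (Fin n) → ℂ :=
    fun z' x => bergmanKernel 1 Ω x z' / bergmanKernel 1 Ω x z with hF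
  set u : Set (EuclideanSpace ℂ (Fin n)) :=
    {x | ∃ C > 0, ∀ᶠ y in 𝓝 x, ∀ z' ∈ L, ‖F z' y - 1‖ ≤ C * e z'} with hu
  have hlocal : ∀ x ∈ Ω, bergmanKernel 1 Ω x z ≠ 0 → ∃ r > 0, ∃ C > 0, ∀ z' ∈ L,
      ∀ y ∈ ball x r, ‖F z' y - F z' x‖ ≤ C * e z' := by
    intro x hx hxz
    obtain ⟨r, hr, C, hC, h⟩ := exists_norm_div_sub_div_le hΩ hL hLΩ hz hx hxz
    refine ⟨r, hr, C, hC, fun z' hz' y hy => (h z' hz' y hy).trans ?_⟩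
    gcongr
    exact le_add_of_nonneg_right (norm_nonneg _)
  have huo : IsOpen u := by
    refine isOpen_iff_mem_nhds.2 fun x ⟨C, hC, hx⟩ => ?_
    filter_upwards [hx.eventually_nhds] with y hy using ⟨C, hC, hy⟩
  have hzu : z ∈ u := by
    obtain ⟨r, hr, C, hC, h⟩ := hlocal z hzΩ (hne z hz)
    obtain ⟨C₁, hC₁, h₁⟩ := exists_forall_norm_sub_le hΩ.isOpen hL hLΩ
    obtain ⟨C₂, hC₂, h₂⟩ := exists_abs_diagKernel_one_sub_le hΩ hL hLΩ
    have hK := diagKernel_one_pos hΩ hzΩ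
    refine ⟨C + (C₁ + C₂) / diagKernel 1 Ω z, by positivity, ?_⟩
    filter_upwards [ball_mem_nhds z hr] with y hy z' hz'
    have h3 := h z' hz' y hy
    have h4 : ‖F z' z - 1‖ ≤ (C₁ + C₂) / diagKernel 1 Ω z * e z' := by
      have hK0 : (diagKernel 1 Ω z : ℂ) ≠ 0 := by exact_mod_cast hK.ne'
      -- Passing through K_1(z',z') = K_1(z') reduces the base case to the Lipschitz bounds for k'
      -- and for K_1.
      have h5 : F z' z - 1 = ((bergmanKernel 1 Ω z z' - bergmanKernel 1 Ω z' z')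
          + ((diagKernel 1 Ω z' - diagKernel 1 Ω z : ℝ) : ℂ)) / (diagKernel 1 Ω z : ℂ) := by
        simp only [hF]
        rw [bergmanKernel_one_self hΩ hzΩ, bergmanKernel_one_self hΩ (hLΩ hz')]
        field_simp
        push_cast
        ring
      have h6 := h₁ _ (bergmanKernel_one_mem hΩ (hLΩ hz')) z' hz' z hz
      rw [pNorm_bergmanKernel_one hΩ (hLΩ hz'), mul_one] at h6
      have h7 := h₂ z' hz' z hz
      rw [norm_sub_rev] at h7
      rw [h5, norm_div, Complex.norm_real, Real.norm_of_nonneg hK.le, div_mul_eq_mul_div]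
      gcongr
      refine (norm_add_le _ _).trans ?_
      rw [Complex.norm_real, Real.norm_eq_abs]
      calc _ ≤ C₁ * ‖z - z'‖ + C₂ * ‖z - z'‖ := by gcongr
        _ = (C₁ + C₂) * ‖z - z'‖ := by ring
        _ ≤ _ := by
          gcongr
          exact le_add_of_nonneg_left (Real.sqrt_nonneg _)
    have h8 : F z' y - 1 = (F z' y - F z' z) + (F z' z - 1) := by ring
    rw [h8, add_mul]
    exact (norm_add_le _ _).trans (add_le_add h3 h4)
  have hsub : {x ∈ Ω | bergmanKernel 1 Ω x z ≠ 0} ⊆ u := by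
    have hk := ((mem_bergmanSpace_one hΩ.isOpen).1 (bergmanKernel_one_mem hΩ hzΩ)).1
    refine (hk.isPreconnected_setOf_ne_zero hΩ.isOpen
      hΩ.isConnected.isPreconnected).subset_of_closure_inter_subset huo
      ⟨z, ⟨hzΩ, hne z hz⟩, hzu⟩ ?_
    rintro x ⟨hxu, hxΩ, hxz⟩
    obtain ⟨r, hr, C, hC, h⟩ := hlocal x hxΩ hxz
    obtain ⟨y, ⟨C', hC', hy⟩, hxy⟩ := mem_closure_iff.1 hxu r hr
    -- One C for the passage from w to the centre x, one from x to the good point y, and C' for the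
    -- bound at y.
    refine ⟨2 * C + C', by positivity, ?_⟩
    filter_upwards [ball_mem_nhds x hr] with w hw z' hz'
    have h1 := h z' hz' w hw
    have h2 := h z' hz' y (by rwa [mem_ball, dist_comm])
    have h3 := hy.self_of_nhds z' hz'
    have h4 : F z' w - 1 = (F z' w - F z' x) - (F z' y - F z' x) + (F z' y - 1) := by ring
    rw [h4]
    linarith [norm_add_le ((F z' w - F z' x) - (F z' y - F z' x)) (F z' y - 1),
      norm_sub_le (F z' w - F z' x) (F z' y - F z' x)]
  refine hL.induction_on (p := fun s => ∃ C > 0, ∀ x ∈ s, ∀ z' ∈ L, ‖F z' x - 1‖ ≤ C * e z')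
    ⟨1, one_pos, by simp⟩ ?_ ?_ ?_
  · rintro s t hst ⟨C, hC, h⟩
    exact ⟨C, hC, fun x hx => h x (hst hx)⟩
  · rintro s t ⟨C, hC, h⟩ ⟨C', hC', h'⟩
    refine ⟨C + C', by positivity, ?_⟩
    rintro x (hx | hx) z' hz'
    · exact (h x hx z' hz').trans (mul_le_mul_of_nonneg_right (by linarith) (he0 z'))
    · exact (h' x hx z' hz').trans (mul_le_mul_of_nonneg_right (by linarith) (he0 z'))
  · intro x hx
    obtain ⟨C, hC, h⟩ := hsub ⟨hLΩ hx, hne x hx⟩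
    exact ⟨_, mem_nhdsWithin_of_mem_nhds h, C, hC, fun y hy => hy⟩

end PBergman

/-! ### Conclusion. -/

theorem theorem3p3 {n : ℕ} (Ω : Set (EuclideanSpace ℂ (Fin n)))
    (hΩ : PBergman.IsBoundedDomain Ω) (z : EuclideanSpace ℂ (Fin n)) (hz : z ∈ Ω)
    (U : Set (EuclideanSpace ℂ (Fin n))) (hU : U ∈ 𝓝 z) (hUc : IsCompact (closure U))
    (hUsub : closure U ⊆ Ω \ PBergman.zeroSet Ω z) :
    ∃ C : ℝ, 0 < C ∧ ∀ ζ ∈ U, ∀ z' ∈ U,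
      ‖PBergman.bergmanKernel 1 Ω ζ z - PBergman.bergmanKernel 1 Ω ζ z'‖ ≤
        C * ‖z - z'‖ ^ (1 / 2 : ℝ) *
          (PBergman.pNorm 1 Ω
              (fun w => PBergman.bergmanKernel 1 Ω w z - PBergman.bergmanKernel 1 Ω w z')
                ^ (1 / 2 : ℝ)
            + ‖z - z'‖ ^ (1 / 2 : ℝ)) := by
  have hUΩ : closure U ⊆ Ω := hUsub.trans sdiff_subset
  have hne : ∀ x ∈ closure U, PBergman.bergmanKernel 1 Ω x z ≠ 0 := fun x hx h0 =>
    (hUsub hx).2 ⟨hUΩ hx, h0⟩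
  obtain ⟨C, hC, h⟩ := PBergman.exists_norm_div_sub_one_le hΩ hUc hUΩ
    (subset_closure (mem_of_mem_nhds hU)) hne
  obtain ⟨M, hM, hMle⟩ := PBergman.exists_forall_norm_le hΩ.isOpen hUc hUΩ
  refine ⟨M * C, by positivity, fun ζ hζ z' hz' => ?_⟩
  have h1 := h ζ (subset_closure hζ) z' (subset_closure hz')
  have h2 := hMle _ (PBergman.bergmanKernel_one_mem hΩ hz) ζ (subset_closure hζ)
  rw [PBergman.pNorm_bergmanKernel_one hΩ hz, mul_one] at h2
  have hζ0 := hne ζ (subset_closure hζ)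
  set N := PBergman.pNorm 1 Ω
    (fun w => PBergman.bergmanKernel 1 Ω w z - PBergman.bergmanKernel 1 Ω w z')
  have h3 : PBergman.bergmanKernel 1 Ω ζ z - PBergman.bergmanKernel 1 Ω ζ z'
      = -(PBergman.bergmanKernel 1 Ω ζ z *
        (PBergman.bergmanKernel 1 Ω ζ z' / PBergman.bergmanKernel 1 Ω ζ z - 1)) := by
    field_simp
    ring
  rw [h3, norm_neg, norm_mul]
  simp only [← Real.sqrt_eq_rpow]
  calc _ ≤ M * (C * (√(‖z - z'‖ * N) + ‖z - z'‖)) := by gcongr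
    _ = M * C * (√‖z - z'‖ * √N + √‖z - z'‖ * √‖z - z'‖) := by
      rw [Real.sqrt_mul (norm_nonneg _), Real.mul_self_sqrt (norm_nonneg _), mul_assoc]
    _ = _ := by ring
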